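/- Let $G$ be a finite connected plane graph (a planar graph drawn in the plane without crossings; loops and parallel edges are allowed), let $e^*$ be an edge of $G$, and let every edge $e$ of $G$ be given a list $L(e)$ of exactly $9$ colors. A \emph{facial path} of $G$ is a path (with pairwise distinct vertices) formed by consecutive edges on the boundary walk of some face of $G$. A partial edge-coloring is \emph{facially non-repetitive} if there is no $j\ge 1$ and no facial path with $2j$ edges, all of them colored, on which the sequence of colors of the first $j$ edges equals the sequence of colors of the last $j$ edges. Then there exists a facially non-repetitive partial edge-coloring of $G$ in which $e^*$ is uncolored, every other edge is colored, and every colored edge $e$ has a color from $L(e)$. -/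

import Mathlib

/-- A plane graph with vertex type `V` and edge type `E`, the plane being identified with `ℂ`:
vertices are distinct points, the edge `e` is a simple arc from its tail to its head (a simple
closed curve if `e` is a loop), and the interior of an edge contains no vertex and no point of
another edge. Loops and parallel edges are allowed. The direction from tail to head is only
a parametrisation. -/
structure PlaneGraph (V E : Type*) where
  /-- the position of a vertex in the plane -/
  pos : V → ℂ
  tail : E → V
  head : E → V
  /-- the arc that represents an edge -/
  arc : ∀ e : E, Path (pos (tail e)) (pos (head e))
  pos_injective : Function.Injective pos
  arc_simple : ∀ (e : E) (s t : unitInterval), s < t → arc e s = arc e t → s = 0 ∧ t = 1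
  arc_eq_pos : ∀ (e : E) (t : unitInterval) (v : V), arc e t = pos v → t = 0 ∨ t = 1
  arc_eq_arc : ∀ (e f : E) (s t : unitInterval), e ≠ f → arc e s = arc f t → s = 0 ∨ s = 1

namespace PlaneGraph

variable {V E : Type*}

/-- The two darts (directed edges) of `e` are `(e, true)`, from tail to head, and `(e, false)`,
from head to tail. -/
def rev (d : E × Bool) : E × Bool := (d.1, !d.2)

/-- The vertex at which a dart starts. -/
def source (G : PlaneGraph V E) (d : E × Bool) : V :=
  if d.2 then G.tail d.1 else G.head d.1

/-- The vertex at which a dart ends. -/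
def target (G : PlaneGraph V E) (d : E × Bool) : V :=
  if d.2 then G.head d.1 else G.tail d.1

/-- The arc of a dart, traversed from its source to its target. -/
noncomputable def curve (G : PlaneGraph V E) (d : E × Bool) (t : unitInterval) : ℂ :=
  if d.2 then G.arc d.1 t else (G.arc d.1).symm t

/-- Any two vertices are joined by a walk. -/
def Connected (G : PlaneGraph V E) : Prop :=
  ∀ u v : V, Relation.ReflTransGen (fun x y => ∃ d, G.source d = x ∧ G.target d = y) u v

/-- A radius so small that every dart leaves the closed disc of that radius around its source. -/
noncomputable def radius (G : PlaneGraph V E) : ℝ :=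
  (⨅ d : E × Bool, ⨆ t : unitInterval, dist (G.curve d t) (G.curve d 0)) / 2

/-- The first point of a dart on the circle of radius `G.radius` around its source. -/
noncomputable def exitPoint (G : PlaneGraph V E) (d : E × Bool) : ℂ :=
  G.curve d (sInf {t : unitInterval | dist (G.curve d t) (G.curve d 0) = G.radius})

/-- The angular position of a dart around its source. The initial pieces, up to their exit points,
of the darts with source `v` are arcs inside a disc around `v` that end on its boundary circle and
share only `v`, so the cyclic order of the exit points on this circle is the cyclic order
in which the darts leave `v` (and would be the same for any smaller radius). -/
noncomputable def angle (G : PlaneGraph V E) (d : E × Bool) : ℝ :=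
  Complex.arg (G.exitPoint d - G.curve d 0)

/-- The counterclockwise angle, in `(0, 2π]`, from the dart `d` to the dart `d'`; it is `2π` for
`d' = d`. -/
noncomputable def ccwAngle (G : PlaneGraph V E) (d d' : E × Bool) : ℝ :=
  toIocMod Real.two_pi_pos 0 (G.angle d' - G.angle d)

/-- `d'` is the counterclockwise successor of `d` among the darts with the same source (it is `d`
itself if there is no other such dart). -/
def IsRotationSucc (G : PlaneGraph V E) (d d' : E × Bool) : Prop :=
  G.source d' = G.source d ∧
    ∀ d'' : E × Bool, G.source d'' = G.source d → G.ccwAngle d d' ≤ G.ccwAngle d d''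

/-- `d'` follows `d` on the boundary walk of the face to the right of `d`: arriving along `d`,
continue along the next dart counterclockwise after the reverse of `d`. -/
def FaceStep (G : PlaneGraph V E) (d d' : E × Bool) : Prop :=
  G.IsRotationSucc (rev d) d'

/-- The vertices visited by a walk given by its list of darts. -/
def vertices (G : PlaneGraph V E) : List (E × Bool) → List V
  | [] => []
  | d :: p => G.source d :: (d :: p).map G.target

/-- A facial path: consecutive darts on the boundary walk of a face that form a path, i.e. the
visited vertices are distinct. (Every boundary walk is traversed with its face on the right; this
loses nothing, as the reverse of a repetition is a repetition.) -/
def IsFacialPath (G : PlaneGraph V E) (p : List (E × Bool)) : Prop :=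
  p.IsChain G.FaceStep ∧ (G.vertices p).Nodup

/-- A partial edge-coloring (`none` means uncolored) is facially non-repetitive if there is no
facial path with `2j` edges, `j ≥ 1`, all of them colored, on which the sequence of colors of the
first half equals that of the second half. -/
def IsFaciallyNonrepetitive {C : Type*} (G : PlaneGraph V E) (φ : E → Option C) : Prop :=
  ∀ p : List (E × Bool), G.IsFacialPath p →
    ∀ w : List C, w ≠ [] → p.map (fun d => φ d.1) ≠ (w ++ w).map some

end PlaneGraph

/-! The proof is Rosenfeld's counting argument. Call a list coloring of exactly the edges of `S`
good if it is non-repetitive. If `e ∈ S` is facially adjacent to an edge outside `S`, then `S` has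
at least 3 times as many good colorings as `S \ {e}` (`three_mul_card_le`). Indeed, if the latter
number is c, there are 9c extensions to `e`. A bad one repeats on a trail of 2j edges through `e`.
The half containing `e` copies the other half, so the coloring is determined by its restriction off
that half, and by induction there are at most c / 3^(j-1) such restrictions. The uncolored neighbor
of `e` leaves at most 2j + 1 trails (`card_starts_le`), and the sum of (2j + 1) / 3^(j-1) over j ≥ 1
is 6, so at least 9c - 6c = 3c extensions are good.

Connectedness guarantees that every nonempty `S` avoiding `eStar` has such an edge `e`, so the count
stays positive up to the set of all edges but `eStar`. Plane geometry enters only through the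
rotation at each vertex: it makes the face step a permutation of the darts (`exists_perm_faceStep`),
and facial adjacency connects all edges (`Connected.mem_of_adjacent_closed`). -/

namespace FacialColoring

open Finset

variable {E C : Type*}

/-- The edges met by following `f` from the dart `x`. -/
def edgeAt (f : Equiv.Perm (E × Bool)) (x : E × Bool) (i : ℕ) : E := ((f ^ i) x).1

/-- No trail that follows `f` carries a repetition. -/
def Nonrepetitive (f : Equiv.Perm (E × Bool)) (φ : E → Option C) : Prop :=
  ∀ x j, 0 < j → Set.InjOn (edgeAt f x) (Set.Iio (2 * j)) →
    (∀ i < 2 * j, φ (edgeAt f x i) ≠ none) →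
    ¬ ∀ i < j, φ (edgeAt f x i) = φ (edgeAt f x (i + j))

/-- Two edges are consecutive along an orbit of `f`. -/
def Adjacent (f : Equiv.Perm (E × Bool)) (e e' : E) : Prop :=
  ∃ d : E × Bool, d.1 = e ∧ (f d).1 = e' ∨ d.1 = e' ∧ (f d).1 = e

open scoped Classical in
/-- The list colorings of the edges of `S`. -/
noncomputable def listColorings [Fintype E] (L : E → Finset C) (S : Finset E) :
    Finset (E → Option C) :=
  Fintype.piFinset fun e => if e ∈ S then (L e).map .some else {none}

open scoped Classical in
/-- The non-repetitive list colorings of the edges of `S`. -/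
noncomputable def goodColorings [Fintype E] (f : Equiv.Perm (E × Bool)) (L : E → Finset C)
    (S : Finset E) : Finset (E → Option C) :=
  (listColorings L S).filter (Nonrepetitive f)

/-- The coloring `φ` with the edges of `H` uncolored. -/
def erase (φ : E → Option C) (H : Finset E) [DecidableEq E] : E → Option C :=
  fun e => if e ∈ H then none else φ e

/-! ### Trails along a permutation of the darts. -/

section Basic

variable {f : Equiv.Perm (E × Bool)} {φ ψ : E → Option C}

theorem edgeAt_succ (x : E × Bool) (i : ℕ) :
    Adjacent f (edgeAt f x i) (edgeAt f x (i + 1)) :=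
  ⟨(f ^ i) x, .inl ⟨rfl, by simp [edgeAt, pow_succ']⟩⟩

theorem Adjacent.symm {e e' : E} (h : Adjacent f e e') : Adjacent f e' e := by
  obtain ⟨d, h | h⟩ := h
  · exact ⟨d, .inr h⟩
  · exact ⟨d, .inl h⟩

theorem Nonrepetitive.mono (h : Nonrepetitive f φ) (hψ : ∀ e, ψ e ≠ none → ψ e = φ e) :
    Nonrepetitive f ψ := by
  intro x j hj hinj hcol hrep
  have key : ∀ i < 2 * j, ψ (edgeAt f x i) = φ (edgeAt f x i) := fun i hi => hψ _ (hcol i hi)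
  refine h x j hj hinj (fun i hi => key i hi ▸ hcol i hi) fun i hi => ?_
  rw [← key i (by omega), ← key (i + j) (by omega)]
  exact hrep i hi

theorem mem_goodColorings [Fintype E] {L : E → Finset C} {S : Finset E} :
    φ ∈ goodColorings f L S ↔ φ ∈ listColorings L S ∧ Nonrepetitive f φ := by
  simp [goodColorings]

/-- The starts of the trails with `2 * j` edges that stay in `S` and contain `e`. -/
theorem card_starts_le [DecidableEq E] {S : Finset E} {e e' : E} (he' : e' ∉ S) (hadj : Adjacent f e e') {j : ℕ}
    (B : Finset (E × Bool))
    (hB : ∀ x ∈ B, (∀ i < 2 * j, edgeAt f x i ∈ S) ∧ ∃ i < 2 * j, edgeAt f x i = e) :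
    B.card ≤ 2 * j + 1 := by
  -- One orientation of `e` is directly followed or preceded by `e'`, so a trail inside `S` can use
  -- it only in its last or first position. The other orientation may take any of the 2j positions.
  obtain ⟨b, n, hn⟩ : ∃ (b : Bool) (n : ℕ), ∀ x ∈ B, ∀ i < 2 * j, (f ^ i) x = (e, b) → i = n := by
    obtain ⟨⟨e₁, b⟩, ⟨h1, h2⟩ | ⟨h1, h2⟩⟩ := hadj
    · refine ⟨b, 2 * j - 1, fun x hx i hi h => ?_⟩
      by_contra hne
      have := (hB x hx).1 (i + 1) (by omega)
      rw [edgeAt, pow_succ', Equiv.Perm.mul_apply, h, ← show e₁ = e from h1, h2] at this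
      exact he' this
    · refine ⟨(f (e₁, b)).2, 0, fun x hx i hi h => ?_⟩
      by_contra hne
      obtain ⟨m, rfl⟩ := Nat.exists_eq_succ_of_ne_zero hne
      rw [Nat.succ_eq_add_one, pow_succ', Equiv.Perm.mul_apply, ← h2, Prod.mk.eta] at h
      have := (hB x hx).1 m (by omega)
      rw [edgeAt, f.injective h] at this
      exact he' (h1 ▸ this)
  have hsub : B ⊆ insert ((f ^ n).symm (e, b))
      ((range (2 * j)).image fun i => (f ^ i).symm (e, !b)) := by
    intro x hx
    obtain ⟨i, hi, hie⟩ := (hB x hx).2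
    rw [mem_insert, mem_image]
    by_cases hb : ((f ^ i) x).2 = b
    · have h : (f ^ i) x = (e, b) := Prod.ext hie hb
      have := hn x hx i hi h
      subst this
      exact .inl ((Equiv.symm_apply_eq _).2 h.symm).symm
    · have h : (f ^ i) x = (e, !b) := Prod.ext hie (Bool.eq_not.2 hb)
      exact .inr ⟨i, mem_range.2 hi, (Equiv.symm_apply_eq _).2 h.symm⟩
  refine (card_le_card hsub).trans ((card_insert_le _ _).trans ?_)
  exact Nat.add_le_add_right (card_image_le.trans (card_range _).le) 1

/-- With j = k + 1, this is the number of trails times the fraction of bad colorings for each. The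
full series equals 6, which is what lists of size 9 = 6 + 3 can afford. -/
theorem sum_weights_le (N : ℕ) :
    ∑ k ∈ range N, (2 * (k + 1) + 1 : ℚ) * (1 / 3) ^ k ≤ 6 := by
  have h : ∑ k ∈ range N, (2 * (k + 1) + 1 : ℚ) * (1 / 3) ^ k = 6 - (3 * N + 6) * (1 / 3) ^ N := by
    induction N with
    | zero => norm_num
    | succ n ih => rw [sum_range_succ, ih]; push_cast; ring
  rw [h, sub_le_self_iff]
  positivity

end Basic

/-! ### The counting induction. -/

section Counting

variable [Fintype E] [DecidableEq E] {f : Equiv.Perm (E × Bool)} {L : E → Finset C} {S : Finset E}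
  {φ : E → Option C}

theorem mem_listColorings :
    φ ∈ listColorings L S ↔
      (∀ e ∈ S, ∃ c ∈ L e, φ e = some c) ∧ ∀ e ∉ S, φ e = none := by
  simp only [listColorings, Fintype.mem_piFinset]
  constructor
  · refine fun h => ⟨fun e he => ?_, fun e he => ?_⟩
    · have := h e
      simp only [he, if_true, mem_map] at this
      obtain ⟨c, hc, h⟩ := this
      exact ⟨c, hc, h.symm⟩
    · simpa [he] using h e
  · rintro ⟨h1, h2⟩ e
    by_cases he : e ∈ S
    · obtain ⟨c, hc, h⟩ := h1 e he
      simp [he, h, hc]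
    · simp [he, h2 e he]

theorem mem_of_mem_listColorings (hφ : φ ∈ listColorings L S) {e : E} (he : φ e ≠ none) :
    e ∈ S := by
  by_contra h
  exact he ((mem_listColorings.1 hφ).2 e h)

theorem erase_mem_listColorings (hφ : φ ∈ listColorings L S) (H : Finset E) :
    erase φ H ∈ listColorings L (S \ H) := by
  rw [mem_listColorings] at hφ ⊢
  refine ⟨fun e he => ?_, fun e he => ?_⟩
  · rw [mem_sdiff] at he
    simpa [erase, he.2] using hφ.1 e he.1
  · by_cases h : e ∈ H
    · simp [erase, h]
    · simpa [erase, h] using hφ.2 e (by simpa [h] using he)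

/-- Removing a segment of a trail edge by edge, starting from one of its edges. -/
theorem pow_mul_card_le (x : E × Bool) (n k : ℕ) (hinj : Set.InjOn (edgeAt f x) (Set.Iio n))
    (hS : ∀ i < n, edgeAt f x i ∈ S)
    (ih : ∀ T ⊂ S, ∀ e ∈ T, ∀ e' ∉ T, Adjacent f e e' →
      3 * (goodColorings f L (T.erase e)).card ≤ (goodColorings f L T).card)
    (l r : ℕ) (hl : l ≤ k) (hr : k + 1 + r ≤ n) :
    3 ^ (l + r) * (goodColorings f L (S \ (Ico (k - l) (k + 1 + r)).image (edgeAt f x))).card ≤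
      (goodColorings f L (S.erase (edgeAt f x k))).card := by
  -- The next edge `i` removed is adjacent to the already removed edge `i'`, and what is left is a
  -- proper subset of `S`, so `ih` applies.
  have step : ∀ p q i i', p ≤ i' → i' < q → q ≤ n → i < n → i ∉ Ico p q →
      Adjacent f (edgeAt f x i) (edgeAt f x i') →
      3 * (goodColorings f L (S \ (insert i (Ico p q)).image (edgeAt f x))).card ≤
        (goodColorings f L (S \ (Ico p q).image (edgeAt f x))).card := by
    intro p q i i' hpi hiq hqn hin hi hadj
    have hi' : edgeAt f x i' ∈ (Ico p q).image (edgeAt f x) :=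
      mem_image_of_mem _ (mem_Ico.2 ⟨hpi, hiq⟩)
    have key := ih (S \ (Ico p q).image (edgeAt f x))
      ((ssubset_iff_of_subset sdiff_subset).2
        ⟨_, hS i' (by omega), fun h => (mem_sdiff.1 h).2 hi'⟩) (edgeAt f x i)
      (mem_sdiff.2 ⟨hS i hin, fun h => by
        obtain ⟨m, hm, hme⟩ := mem_image.1 h
        have := hinj (Set.mem_Iio.2 (by have := (mem_Ico.1 hm).2; omega)) (Set.mem_Iio.2 hin) hme
        exact hi (this ▸ hm)⟩)
      (edgeAt f x i') (fun h => (mem_sdiff.1 h).2 hi') hadj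
    rwa [image_insert, sdiff_insert]
  induction l with
  | zero =>
    induction r with
    | zero => simp [← sdiff_singleton_eq_erase]
    | succ r ihr =>
      refine le_trans ?_ (ihr (by omega))
      have := step (k - 0) (k + 1 + r) (k + 1 + r) (k + r) (by omega) (by omega) (by omega)
        (by omega) (by simp) (by
          have := (edgeAt_succ (f := f) x (k + r)).symm
          rwa [show k + r + 1 = k + 1 + r by omega] at this)
      rw [show insert (k + 1 + r) (Ico (k - 0) (k + 1 + r)) = Ico (k - 0) (k + 1 + (r + 1)) by
        ext m; simp only [mem_insert, mem_Ico]; omega] at this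
      rw [show 0 + (r + 1) = 0 + r + 1 by omega, pow_succ, mul_assoc]
      exact Nat.mul_le_mul_left _ this
  | succ l ihl =>
    refine le_trans ?_ (ihl (by omega))
    have := step (k - l) (k + 1 + r) (k - (l + 1)) (k - l) (by omega) (by omega) (by omega)
      (by omega) (by simp only [mem_Ico]; omega) (by
        have := edgeAt_succ (f := f) x (k - (l + 1))
        rwa [show k - (l + 1) + 1 = k - l by omega] at this)
    rw [show insert (k - (l + 1)) (Ico (k - l) (k + 1 + r)) = Ico (k - (l + 1)) (k + 1 + r) by
      ext m; simp only [mem_insert, mem_Ico]; omega] at this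
    rw [show l + 1 + r = l + r + 1 by omega, pow_succ, mul_assoc]
    exact Nat.mul_le_mul_left _ this

/-- The colorings that repeat on a given trail through `e` are few. -/
theorem pow_mul_card_repetitive_le {e : E} {X : Finset (E → Option C)}
    (hX : ∀ φ ∈ X, φ ∈ listColorings L S ∧ Nonrepetitive f (erase φ {e}))
    (x : E × Bool) (j k : ℕ) (hk : k < 2 * j) (hke : edgeAt f x k = e)
    (hinj : Set.InjOn (edgeAt f x) (Set.Iio (2 * j))) (hS : ∀ i < 2 * j, edgeAt f x i ∈ S)
    (hXrep : ∀ φ ∈ X, ∀ i < j, φ (edgeAt f x i) = φ (edgeAt f x (i + j)))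
    (ih : ∀ T ⊂ S, ∀ e ∈ T, ∀ e' ∉ T, Adjacent f e e' →
      3 * (goodColorings f L (T.erase e)).card ≤ (goodColorings f L T).card) :
    3 ^ (j - 1) * X.card ≤ (goodColorings f L (S.erase e)).card := by
  -- `a` is the start of the half that contains `e`.
  obtain ⟨a, ha, hak, hkj⟩ : ∃ a, (a = 0 ∨ a = j) ∧ a ≤ k ∧ k < a + j := by
    by_cases h : k < j
    · exact ⟨0, .inl rfl, by omega, by omega⟩
    · exact ⟨j, .inr rfl, by omega, by omega⟩
  have h1 := pow_mul_card_le (L := L) x (2 * j) k hinj hS ih (k - a) (a + j - 1 - k) (by omega)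
    (by omega)
  rw [show k - a + (a + j - 1 - k) = j - 1 by omega, show k - (k - a) = a by omega,
    show k + 1 + (a + j - 1 - k) = a + j by omega, hke] at h1
  refine le_trans (Nat.mul_le_mul_left _ ?_) h1
  set H := (Ico a (a + j)).image (edgeAt f x) with hH
  have heH : e ∈ H := hke ▸ mem_image_of_mem _ (mem_Ico.2 ⟨hak, hkj⟩)
  -- Erasing `H` is injective on `X`: the repetition restores the lost colors from the other half,
  -- which is disjoint from `H` because the edges of the trail are distinct.
  refine card_le_card_of_injOn (fun φ => erase φ H) (fun φ hφ => ?_) fun φ hφ ψ hψ heq => ?_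
  · refine mem_goodColorings.2 ⟨erase_mem_listColorings (hX φ hφ).1 H,
      (hX φ hφ).2.mono fun e' he' => ?_⟩
    have h : e' ∉ H := fun h => he' (by simp [erase, h])
    have h' : e' ≠ e := fun h' => h (h' ▸ heH)
    simp [erase, h, h']
  · have off : ∀ e' ∉ H, φ e' = ψ e' := fun e' h => by
      have := congrFun heq e'
      simpa [erase, h] using this
    funext e'
    by_cases h : e' ∈ H
    · obtain ⟨i, hi, rfl⟩ := mem_image.1 h
      rw [mem_Ico] at hi
      have out : ∀ m < 2 * j, m ∉ Ico a (a + j) → edgeAt f x m ∉ H := by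
        intro m hm hmI hmH
        obtain ⟨m', hm', hme⟩ := mem_image.1 hmH
        have := hinj (Set.mem_Iio.2 (by have := mem_Ico.1 hm'; omega)) (Set.mem_Iio.2 hm) hme
        exact hmI (this ▸ hm')
      rcases ha with rfl | rfl
      · rw [hXrep φ hφ i (by omega), hXrep ψ hψ i (by omega)]
        exact off _ (out _ (by omega) (by simp))
      · have e1 := hXrep φ hφ (i - a) (by omega)
        have e2 := hXrep ψ hψ (i - a) (by omega)
        rw [Nat.sub_add_cancel hi.1] at e1 e2
        rw [← e1, ← e2]
        exact off _ (out _ (by omega) (by simp only [mem_Ico]; omega))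
    · exact off _ h

/-- Strong induction on `S`: the bound for all proper subsets limits how many extensions to `e` can
be bad. -/
theorem three_mul_card_le (hL : ∀ e, (L e).card = 9) (S : Finset E) :
    ∀ e ∈ S, ∀ e' ∉ S, Adjacent f e e' →
      3 * (goodColorings f L (S.erase e)).card ≤ (goodColorings f L S).card := by
  classical
  induction S using Finset.strongInduction with
  | H S ih =>
  intro e he e' he' hadj
  set c := (goodColorings f L (S.erase e)).card with hc
  set X := (goodColorings f L (S.erase e) ×ˢ L e).image
    fun p => Function.update p.1 e (some p.2) with hXdef
  have hnone : ∀ φ ∈ goodColorings f L (S.erase e), φ e = none := fun φ hφ =>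
    (mem_listColorings.1 (mem_goodColorings.1 hφ).1).2 e (by simp)
  have hXcard : X.card = c * 9 := by
    rw [hXdef, card_image_of_injOn, card_product, hL]
    rintro ⟨φ, a⟩ hφ ⟨ψ, b⟩ hψ h
    simp only [coe_product, Set.mem_prod, mem_coe] at hφ hψ
    refine Prod.ext ?_ ?_
    · funext e₁
      by_cases h1 : e₁ = e
      · exact h1 ▸ (hnone φ hφ.1).trans (hnone ψ hψ.1).symm
      · simpa [h1] using congrFun h e₁
    · simpa using congrFun h e
  have hX : ∀ φ ∈ X, φ ∈ listColorings L S ∧ Nonrepetitive f (erase φ {e}) := by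
    intro φ hφ
    obtain ⟨⟨ψ, a⟩, h, rfl⟩ := mem_image.1 hφ
    rw [mem_product] at h
    obtain ⟨hψ, ha⟩ := h
    have h1 := mem_goodColorings.1 hψ
    have h2 := mem_listColorings.1 h1.1
    refine ⟨mem_listColorings.2 ⟨fun e₁ he₁ => ?_, fun e₁ he₁ => ?_⟩, ?_⟩
    · by_cases h : e₁ = e
      · subst h
        exact ⟨a, ha, by simp⟩
      · simpa [h] using h2.1 e₁ (by simp [h, he₁])
    · have h : e₁ ≠ e := fun h => he₁ (h ▸ he)
      simpa [h] using h2.2 e₁ (by simp [he₁])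
    · refine h1.2.mono fun e₁ he₁ => ?_
      have h : e₁ ≠ e := fun h => he₁ (by simp [erase, h])
      simp [erase, h]
  set starts : ℕ → Finset (E × Bool) := fun j => univ.filter fun x =>
    Set.InjOn (edgeAt f x) (Set.Iio (2 * j)) ∧ (∀ i < 2 * j, edgeAt f x i ∈ S) ∧
      ∃ i < 2 * j, edgeAt f x i = e with hstarts
  set rep : ℕ → E × Bool → Finset (E → Option C) := fun j x => X.filter fun φ =>
    ∀ i < j, φ (edgeAt f x i) = φ (edgeAt f x (i + j)) with hrep
  set N := Fintype.card E
  have hcover : X ⊆ goodColorings f L S ∪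
      (range N).biUnion fun k => (starts (k + 1)).biUnion (rep (k + 1)) := by
    intro φ hφ
    rw [mem_union]
    by_cases hgood : Nonrepetitive f φ
    · exact .inl (mem_goodColorings.2 ⟨(hX φ hφ).1, hgood⟩)
    · right
      rw [Nonrepetitive] at hgood
      push Not at hgood
      obtain ⟨x, j, hj, hinj, hcol, hrepj⟩ := hgood
      obtain ⟨k, rfl⟩ := Nat.exists_eq_succ_of_ne_zero hj.ne'
      have hcard : 2 * (k + 1) ≤ N := by
        have := card_le_card_of_injOn (s := range (2 * (k + 1))) (t := (univ : Finset E))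
          (edgeAt f x) (fun _ _ => mem_coe.2 (mem_univ _)) (by simpa using hinj)
        simpa using this
      refine mem_biUnion.2 ⟨k, mem_range.2 (by omega), mem_biUnion.2 ⟨x, ?_, ?_⟩⟩
      · refine mem_filter.2 ⟨mem_univ _, hinj,
          fun i hi => mem_of_mem_listColorings (hX φ hφ).1 (hcol i hi), ?_⟩
        -- A repetition avoiding `e` would already be present before `e` is colored.
        by_contra hno
        push Not at hno
        have key : ∀ i < 2 * (k + 1), erase φ {e} (edgeAt f x i) = φ (edgeAt f x i) := by
          intro i hi
          simp [erase, hno i hi]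
        refine (hX φ hφ).2 x (k + 1) hj hinj (fun i hi => ?_) fun i hi => ?_
        · rw [key i hi]
          exact hcol i hi
        · rw [key i (by omega), key (i + (k + 1)) (by omega)]
          exact hrepj i hi
      · exact mem_filter.2 ⟨hφ, hrepj⟩
  have hrepcard : ∀ k, ∀ x ∈ starts (k + 1), ((rep (k + 1) x).card : ℚ) ≤ (1 / 3) ^ k * c := by
    intro k x hx
    obtain ⟨-, hinj, hS, i, hi, hie⟩ := mem_filter.1 hx
    have := pow_mul_card_repetitive_le (X := rep (k + 1) x) (L := L)
      (fun φ hφ => hX φ (mem_filter.1 hφ).1) x (k + 1) i hi hie hinj hS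
      (fun φ hφ => (mem_filter.1 hφ).2) ih
    rw [Nat.add_sub_cancel, ← hc] at this
    have h3 : (3 : ℚ) ^ k * (rep (k + 1) x).card ≤ c := by exact_mod_cast this
    rw [one_div, inv_pow, inv_mul_eq_div, le_div_iff₀ (by positivity), mul_comm]
    exact h3
  have hbad : (((range N).biUnion fun k => (starts (k + 1)).biUnion (rep (k + 1))).card : ℚ) ≤
      6 * c := by
    calc _ ≤ ((∑ k ∈ range N, ∑ x ∈ starts (k + 1), (rep (k + 1) x).card : ℕ) : ℚ) := by
          exact_mod_cast card_biUnion_le.trans (sum_le_sum fun k _ => card_biUnion_le)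
      _ ≤ ∑ k ∈ range N, (2 * (k + 1) + 1 : ℚ) * (1 / 3) ^ k * c := by
          push_cast
          refine sum_le_sum fun k _ => ?_
          refine (sum_le_sum (hrepcard k)).trans ?_
          rw [sum_const, nsmul_eq_mul, mul_assoc]
          refine mul_le_mul_of_nonneg_right ?_ (by positivity)
          exact_mod_cast card_starts_le he' hadj (starts (k + 1))
            fun x hx => (mem_filter.1 hx).2.2
      _ = (∑ k ∈ range N, (2 * (k + 1) + 1 : ℚ) * (1 / 3) ^ k) * c := by rw [sum_mul]
      _ ≤ 6 * c := mul_le_mul_of_nonneg_right (sum_weights_le N) (by positivity)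
  have hbad' : ((range N).biUnion fun k => (starts (k + 1)).biUnion (rep (k + 1))).card ≤ 6 * c := by
    exact_mod_cast hbad
  have := (card_le_card hcover).trans (card_union_le _ _)
  omega

/-- The complement of `S` contains `eStar`. If `S` is nonempty, the complement is not closed under
adjacency, so some edge of `S` borders it and can be split off. -/
theorem goodColorings_nonempty (hL : ∀ e, (L e).card = 9) (eStar : E)
    (hconn : ∀ T : Finset E, T.Nonempty → (∀ e ∈ T, ∀ e', Adjacent f e e' → e' ∈ T) → T = univ)
    (S : Finset E) (hS : eStar ∉ S) : (goodColorings f L S).Nonempty := by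
  induction S using Finset.strongInduction with
  | H S ih =>
  rcases S.eq_empty_or_nonempty with rfl | hne
  · refine ⟨fun _ => none, mem_goodColorings.2 ⟨mem_listColorings.2 (by simp), ?_⟩⟩
    intro x j hj _ hcol
    exact absurd rfl (hcol 0 (by omega))
  · obtain ⟨e', he', e, hadj, he⟩ : ∃ e' ∉ S, ∃ e, Adjacent f e' e ∧ e ∈ S := by
      by_contra! h
      have := hconn Sᶜ ⟨eStar, mem_compl.2 hS⟩ fun e he e' hadj =>
        mem_compl.2 (h e (mem_compl.1 he) e' hadj)
      rw [compl_eq_univ_iff] at this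
      exact hne.ne_empty this
    have h1 := three_mul_card_le (f := f) hL S e he e' he' hadj.symm
    have h2 := (ih (S.erase e) (erase_ssubset he) fun h => hS (mem_of_mem_erase h)).card_pos
    exact card_pos.1 (by omega)

end Counting

end FacialColoring

namespace PlaneGraph

open FacialColoring

variable {V E : Type*} (G : PlaneGraph V E)

/-! ### Darts as curves, and their exit points. -/

section Curves

theorem rev_rev (d : E × Bool) : rev (rev d) = d := by simp [rev]

theorem source_rev (d : E × Bool) : G.source (rev d) = G.target d := by
  obtain ⟨e, _ | _⟩ := d <;> rfl

theorem target_rev (d : E × Bool) : G.target (rev d) = G.source d := by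
  obtain ⟨e, _ | _⟩ := d <;> rfl

theorem curve_zero (d : E × Bool) : G.curve d 0 = G.pos (G.source d) := by
  obtain ⟨e, _ | _⟩ := d <;> simp [curve, source]

theorem curve_rev (d : E × Bool) (t : unitInterval) :
    G.curve (rev d) t = G.curve d (unitInterval.symm t) := by
  obtain ⟨e, _ | _⟩ := d
  · simp [curve, rev]
    rfl
  · simp only [curve, rev]
    rfl

theorem continuous_curve (d : E × Bool) : Continuous (G.curve d) := by
  obtain ⟨e, _ | _⟩ := d
  · exact (G.arc e).symm.continuous
  · exact (G.arc e).continuous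

theorem curve_simple (d : E × Bool) {s t : unitInterval} (hst : s < t)
    (h : G.curve d s = G.curve d t) : s = 0 ∧ t = 1 := by
  obtain ⟨e, _ | _⟩ := d
  · have := G.arc_simple e (unitInterval.symm t) (unitInterval.symm s)
      (unitInterval.symm_lt_symm.2 hst) (by simpa [curve] using h.symm)
    simpa [and_comm] using this
  · exact G.arc_simple e s t hst (by simpa [curve] using h)

theorem curve_eq_curve {d d' : E × Bool} (hne : d.1 ≠ d'.1) {s t : unitInterval}
    (h : G.curve d s = G.curve d' t) : s = 0 ∨ s = 1 := by
  have key : ∀ (d : E × Bool) s, ∃ s', G.curve d s = G.arc d.1 s' ∧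
      ((s' = 0 ∨ s' = 1) → (s = 0 ∨ s = 1)) := by
    rintro ⟨e, _ | _⟩ s
    · exact ⟨unitInterval.symm s, by simp [curve], by simpa using Or.symm⟩
    · exact ⟨s, by simp [curve], id⟩
  obtain ⟨s', h1, h2⟩ := key d s
  obtain ⟨t', h3, -⟩ := key d' t
  exact h2 (G.arc_eq_arc d.1 d'.1 s' t' hne (by rw [← h1, ← h3, h]))

theorem exists_dist_eq_iSup (d : E × Bool) :
    ∃ t, dist (G.curve d t) (G.curve d 0) = ⨆ s, dist (G.curve d s) (G.curve d 0) ∧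
      0 < dist (G.curve d t) (G.curve d 0) := by
  have hcont : Continuous fun t => dist (G.curve d t) (G.curve d 0) :=
    (G.continuous_curve d).dist continuous_const
  obtain ⟨t, -, ht⟩ := isCompact_univ.exists_isMaxOn Set.univ_nonempty hcont.continuousOn
  have hmax : ∀ s, dist (G.curve d s) (G.curve d 0) ≤ dist (G.curve d t) (G.curve d 0) :=
    fun s => ht (Set.mem_univ s)
  refine ⟨t, le_antisymm (le_ciSup ⟨_, Set.forall_mem_range.2 hmax⟩ t) (ciSup_le hmax), ?_⟩
  -- The midpoint differs from the source even for a loop, where time 1 would not do.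
  refine lt_of_lt_of_le (dist_pos.2 fun h => ?_) (hmax ⟨1 / 2, by norm_num, by norm_num⟩)
  have := (G.curve_simple d (s := 0) (t := ⟨1 / 2, by norm_num, by norm_num⟩)
    (Subtype.coe_lt_coe.1 (by norm_num)) h.symm).2
  have := congrArg Subtype.val this
  norm_num at this

theorem radius_pos [Finite E] [Nonempty E] : 0 < G.radius := by
  obtain ⟨d, hd⟩ := exists_eq_ciInf_of_finite
    (f := fun d : E × Bool => ⨆ t : unitInterval, dist (G.curve d t) (G.curve d 0))
  rw [radius, ← hd]
  obtain ⟨t, h1, h2⟩ := G.exists_dist_eq_iSup d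
  rw [← h1]
  exact half_pos h2

/-- The factor 1/2 in `radius` makes this strict, so darts exit strictly before such a time `t`. -/
theorem exists_radius_lt_dist [Finite E] [Nonempty E] (d : E × Bool) :
    ∃ t, G.radius < dist (G.curve d t) (G.curve d 0) := by
  obtain ⟨t, h1, -⟩ := G.exists_dist_eq_iSup d
  refine ⟨t, ?_⟩
  have h2 : 2 * G.radius ≤ ⨆ t : unitInterval, dist (G.curve d t) (G.curve d 0) := by
    rw [radius, mul_div_cancel₀ _ two_ne_zero]
    exact ciInf_le (Set.finite_range _).bddBelow d
  have := G.radius_pos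
  linarith

/-- The first time at which a dart reaches the circle of radius `G.radius` around its source. -/
noncomputable def exitTime (d : E × Bool) : unitInterval :=
  sInf {t : unitInterval | dist (G.curve d t) (G.curve d 0) = G.radius}

variable [Finite E] [Nonempty E]

theorem exitTime_lt {d : E × Bool} {t : unitInterval}
    (ht : G.radius < dist (G.curve d t) (G.curve d 0)) : G.exitTime d < t := by
  have hcont : Continuous fun t => dist (G.curve d t) (G.curve d 0) :=
    (G.continuous_curve d).dist continuous_const
  obtain ⟨s, hs, hsr⟩ := intermediate_value_Icc (unitInterval.nonneg' (t := t))
    hcont.continuousOn (show G.radius ∈ Set.Icc _ _ from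
      ⟨by simpa using G.radius_pos.le, ht.le⟩)
  refine lt_of_le_of_lt (csInf_le (OrderBot.bddBelow _) hsr) (lt_of_le_of_ne hs.2 ?_)
  rintro rfl
  exact ht.ne' hsr

theorem dist_exitPoint (d : E × Bool) : dist (G.exitPoint d) (G.curve d 0) = G.radius := by
  have hcont : Continuous fun t => dist (G.curve d t) (G.curve d 0) :=
    (G.continuous_curve d).dist continuous_const
  obtain ⟨t, ht⟩ := G.exists_radius_lt_dist d
  obtain ⟨s, hs, hsr⟩ := intermediate_value_Icc (unitInterval.nonneg' (t := t))
    hcont.continuousOn (show G.radius ∈ Set.Icc _ _ from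
      ⟨by simpa using G.radius_pos.le, ht.le⟩)
  have hclosed : IsClosed {t : unitInterval | dist (G.curve d t) (G.curve d 0) = G.radius} :=
    isClosed_eq hcont continuous_const
  exact hclosed.isCompact.sInf_mem ⟨s, hsr⟩

theorem exitTime_ne_zero (d : E × Bool) : G.exitTime d ≠ 0 := by
  intro h
  have h1 : dist (G.curve d (G.exitTime d)) (G.curve d 0) = G.radius := G.dist_exitPoint d
  rw [h, dist_self] at h1
  exact G.radius_pos.ne h1

theorem exitTime_ne_one (d : E × Bool) : G.exitTime d ≠ 1 := by
  obtain ⟨t, ht⟩ := G.exists_radius_lt_dist d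
  exact ((G.exitTime_lt ht).trans_le unitInterval.le_one').ne

/-- Exit points are interior to their arcs, so different edges cannot share one. The two darts of a
loop exit on opposite sides of a time `t` at which the loop is outside the disc, so a common exit
point would contradict simplicity. -/
theorem exitPoint_injective {d d' : E × Bool} (hs : G.source d = G.source d')
    (h : G.exitPoint d = G.exitPoint d') : d = d' := by
  have h' : G.curve d (G.exitTime d) = G.curve d' (G.exitTime d') := h
  by_cases he : d.1 = d'.1
  · by_contra hne
    have hd' : d' = rev d := by
      obtain ⟨e, b⟩ := d
      obtain ⟨e', b'⟩ := d'
      obtain rfl : e = e' := he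
      refine Prod.ext rfl ?_
      exact Bool.eq_not.2 fun hb => hne (by rw [show b' = b from hb])
    subst hd'
    rw [curve_rev] at h'
    obtain ⟨t, ht⟩ := G.exists_radius_lt_dist d
    have h1 := G.exitTime_lt ht
    have h2 : G.exitTime (rev d) < unitInterval.symm t := by
      refine G.exitTime_lt ?_
      rwa [curve_rev, unitInterval.symm_symm, curve_zero, ← hs, ← curve_zero]
    have h3 : t < unitInterval.symm (G.exitTime (rev d)) := by
      rw [← unitInterval.symm_lt_symm, unitInterval.symm_symm]
      exact h2
    exact G.exitTime_ne_zero d (G.curve_simple d (h1.trans h3) h').1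
  · rcases G.curve_eq_curve he h' with h0 | h0
    · exact absurd h0 (G.exitTime_ne_zero d)
    · exact absurd h0 (G.exitTime_ne_one d)

end Curves

/-! ### Rotation at a vertex, and the face permutation. -/

section Angles

theorem ccwAngle_pos (d d' : E × Bool) : 0 < G.ccwAngle d d' :=
  (toIocMod_mem_Ioc Real.two_pi_pos 0 _).1

theorem ccwAngle_le (d d' : E × Bool) : G.ccwAngle d d' ≤ 2 * Real.pi :=
  (toIocMod_mem_Ioc Real.two_pi_pos 0 (G.angle d' - G.angle d)).2.trans (zero_add _).le

theorem ccwAngle_eq (d d' : E × Bool) :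
    ∃ n : ℤ, G.ccwAngle d d' = G.angle d' - G.angle d - n * (2 * Real.pi) := by
  refine ⟨toIocDiv Real.two_pi_pos 0 (G.angle d' - G.angle d), ?_⟩
  have := self_sub_toIocMod Real.two_pi_pos 0 (G.angle d' - G.angle d)
  rw [zsmul_eq_mul] at this
  rw [ccwAngle]
  linarith

theorem eq_zero_of_abs_lt_two_pi {x : ℝ} {n : ℤ} (h : x = n * (2 * Real.pi))
    (h1 : -(2 * Real.pi) < x) (h2 : x < 2 * Real.pi) : x = 0 := by
  have hpi := Real.two_pi_pos
  have hn1 : (-1 : ℝ) < n := by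
    by_contra! hn
    nlinarith
  have hn2 : (n : ℝ) < 1 := by
    by_contra! hn
    nlinarith
  have : n = 0 := by
    have a : (-1 : ℤ) < n := by exact_mod_cast hn1
    have b : n < (1 : ℤ) := by exact_mod_cast hn2
    omega
  simp [h, this]

/-- Both sides agree modulo 2π, and their ranges force the difference to be less than 2π in absolute
value. -/
theorem ccwAngle_sub {d d₁ d₂ : E × Bool} (h : G.ccwAngle d d₁ < G.ccwAngle d d₂) :
    G.ccwAngle d₁ d₂ = G.ccwAngle d d₂ - G.ccwAngle d d₁ := by
  obtain ⟨n, hn⟩ := G.ccwAngle_eq d d₁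
  obtain ⟨m, hm⟩ := G.ccwAngle_eq d d₂
  obtain ⟨k, hk⟩ := G.ccwAngle_eq d₁ d₂
  have := G.ccwAngle_pos d d₁
  have := G.ccwAngle_pos d₁ d₂
  have := G.ccwAngle_le d d₂
  have := G.ccwAngle_le d₁ d₂
  refine sub_eq_zero.1 (eq_zero_of_abs_lt_two_pi (n := m - n - k) ?_ ?_ ?_)
  · push_cast
    linarith
  · linarith
  · linarith

theorem ccwAngle_sub' {d d₁ d₂ : E × Bool} (h : G.ccwAngle d₁ d < G.ccwAngle d₂ d) :
    G.ccwAngle d₂ d₁ = G.ccwAngle d₂ d - G.ccwAngle d₁ d := by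
  obtain ⟨n, hn⟩ := G.ccwAngle_eq d₁ d
  obtain ⟨m, hm⟩ := G.ccwAngle_eq d₂ d
  obtain ⟨k, hk⟩ := G.ccwAngle_eq d₂ d₁
  have := G.ccwAngle_pos d₁ d
  have := G.ccwAngle_pos d₂ d₁
  have := G.ccwAngle_le d₂ d
  have := G.ccwAngle_le d₂ d₁
  refine sub_eq_zero.1 (eq_zero_of_abs_lt_two_pi (n := m - n - k) ?_ ?_ ?_)
  · push_cast
    linarith
  · linarith
  · linarith

theorem exists_isRotationSucc [Finite E] (d : E × Bool) : ∃ d', G.IsRotationSucc d d' := by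
  obtain ⟨d', h1, h2⟩ := Set.exists_min_image {d' | G.source d' = G.source d} (G.ccwAngle d)
    (Set.toFinite _) ⟨d, rfl⟩
  exact ⟨d', h1, h2⟩

variable [Finite E] [Nonempty E]

theorem angle_injective {d d' : E × Bool} (hs : G.source d = G.source d')
    (h : G.angle d = G.angle d') : d = d' := by
  refine G.exitPoint_injective hs ?_
  have h0 : G.curve d 0 = G.curve d' 0 := by rw [curve_zero, curve_zero, hs]
  have := Complex.ext_norm_arg (x := G.exitPoint d - G.curve d 0)
    (y := G.exitPoint d' - G.curve d' 0)
    (by rw [← dist_eq_norm, ← dist_eq_norm, dist_exitPoint, dist_exitPoint]) h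
  rwa [h0, sub_left_inj] at this

theorem eq_of_angle_sub_eq {d d' : E × Bool} (hs : G.source d = G.source d') {n : ℤ}
    (h : G.angle d - G.angle d' = n * (2 * Real.pi)) : d = d' := by
  refine G.angle_injective hs (sub_eq_zero.1 (eq_zero_of_abs_lt_two_pi h ?_ ?_))
  all_goals
    have h1 := Complex.neg_pi_lt_arg (G.exitPoint d - G.curve d 0)
    have h2 := Complex.arg_le_pi (G.exitPoint d - G.curve d 0)
    have h3 := Complex.neg_pi_lt_arg (G.exitPoint d' - G.curve d' 0)
    have h4 := Complex.arg_le_pi (G.exitPoint d' - G.curve d' 0)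
    unfold angle
    linarith

theorem ccwAngle_right_injective {d d₁ d₂ : E × Bool} (hs : G.source d₁ = G.source d₂)
    (h : G.ccwAngle d d₁ = G.ccwAngle d d₂) : d₁ = d₂ := by
  obtain ⟨n, hn⟩ := G.ccwAngle_eq d d₁
  obtain ⟨m, hm⟩ := G.ccwAngle_eq d d₂
  refine G.eq_of_angle_sub_eq hs (n := n - m) ?_
  push_cast
  linarith

theorem ccwAngle_left_injective {d d₁ d₂ : E × Bool} (hs : G.source d₁ = G.source d₂)
    (h : G.ccwAngle d₁ d = G.ccwAngle d₂ d) : d₁ = d₂ := by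
  obtain ⟨n, hn⟩ := G.ccwAngle_eq d₁ d
  obtain ⟨m, hm⟩ := G.ccwAngle_eq d₂ d
  refine G.eq_of_angle_sub_eq hs (n := m - n) ?_
  push_cast
  linarith

variable {G}

theorem IsRotationSucc.unique {d d₁ d₂ : E × Bool} (h₁ : G.IsRotationSucc d d₁)
    (h₂ : G.IsRotationSucc d d₂) : d₁ = d₂ :=
  G.ccwAngle_right_injective (h₁.1.trans h₂.1.symm)
    (le_antisymm (h₁.2 _ h₂.1) (h₂.2 _ h₁.1))

/-- Otherwise the one of `d₁`, `d₂` closer to `d` would lie strictly between the other and its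
successor `d`. -/
theorem IsRotationSucc.injective {d d₁ d₂ : E × Bool} (h₁ : G.IsRotationSucc d₁ d)
    (h₂ : G.IsRotationSucc d₂ d) : d₁ = d₂ := by
  have hs : G.source d₁ = G.source d₂ := h₁.1.symm.trans h₂.1
  rcases lt_trichotomy (G.ccwAngle d₁ d) (G.ccwAngle d₂ d) with h | h | h
  · have := G.ccwAngle_sub' h
    have := h₂.2 d₁ hs
    have := G.ccwAngle_pos d₁ d
    linarith
  · exact G.ccwAngle_left_injective hs h
  · have := G.ccwAngle_sub' h
    have := h₁.2 d₂ hs.symm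
    have := G.ccwAngle_pos d₂ d
    linarith

/-- A set of darts that is closed under rotation contains, with a dart, all darts with the same
source. -/
theorem mem_of_isRotationSucc_closed {T : Set (E × Bool)}
    (hT : ∀ d ∈ T, ∀ d', G.IsRotationSucc d d' → d' ∈ T) {d d' : E × Bool} (hd : d ∈ T)
    (hs : G.source d' = G.source d) : d' ∈ T := by
  by_contra hd'
  -- Take the smallest angle from a dart in `T` to one outside at the same vertex. The successor of
  -- `a` is in `T` and strictly closer to `b`, a contradiction.
  obtain ⟨⟨a, b⟩, ⟨ha, hb, hab⟩, hmin⟩ := Set.exists_min_image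
    {p : (E × Bool) × (E × Bool) | p.1 ∈ T ∧ p.2 ∉ T ∧ G.source p.2 = G.source p.1}
    (fun p => G.ccwAngle p.1 p.2) (Set.toFinite _) ⟨(d, d'), hd, hd', hs⟩
  obtain ⟨c, hc⟩ := G.exists_isRotationSucc a
  have hcT := hT a ha c hc
  have hlt : G.ccwAngle a c < G.ccwAngle a b := by
    refine lt_of_le_of_ne (hc.2 b hab) fun h => ?_
    exact hb (G.ccwAngle_right_injective (hc.1.trans hab.symm) h ▸ hcT)
  have h1 := G.ccwAngle_sub hlt
  have h2 : G.ccwAngle a b ≤ G.ccwAngle c b := hmin (c, b) ⟨hcT, hb, hab.trans hc.1.symm⟩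
  have := G.ccwAngle_pos a c
  linarith

variable (G) in
theorem exists_perm_faceStep :
    ∃ f : Equiv.Perm (E × Bool), ∀ d d', G.FaceStep d d' ↔ d' = f d := by
  choose f hf using fun d : E × Bool => G.exists_isRotationSucc (rev d)
  have hinj : Function.Injective f := fun d₁ d₂ h => by
    have := (hf d₁).injective (h ▸ hf d₂)
    rw [← rev_rev d₁, this, rev_rev]
  refine ⟨Equiv.ofBijective f (Finite.injective_iff_bijective.1 hinj), fun d d' => ?_⟩
  exact ⟨fun h => IsRotationSucc.unique h (hf d), fun h => h ▸ hf d⟩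

end Angles

/-! ### From facial paths and connectedness to trails of the permutation. -/

variable {G}

/-- In a connected plane graph, a nonempty set of edges closed under adjacency along faces contains
every edge. -/
theorem Connected.mem_of_adjacent_closed [Finite E] (hG : G.Connected) {f : Equiv.Perm (E × Bool)}
    (hf : ∀ d d', G.FaceStep d d' ↔ d' = f d) {T : Set E} (hne : T.Nonempty)
    (hT : ∀ e ∈ T, ∀ e', Adjacent f e e' → e' ∈ T) (e : E) : e ∈ T := by
  have : Nonempty E := ⟨e⟩
  have hrot : ∀ d d' : E × Bool, d.1 ∈ T → G.source d' = G.source d → d'.1 ∈ T := by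
    intro d d' hd hs
    refine mem_of_isRotationSucc_closed (G := G) (T := {d | d.1 ∈ T}) (fun a ha b hab => ?_) hd hs
    -- Rotating from `a` to `b` is the face step from `rev a` to `b`, so their edges are adjacent.
    refine hT a.1 ha b.1 ⟨rev a, .inl ⟨rfl, ?_⟩⟩
    rw [← (hf (rev a) b).1 (by rwa [FaceStep, rev_rev])]
  obtain ⟨e₀, he₀⟩ := hne
  have hvert : ∀ v, Relation.ReflTransGen (fun x y => ∃ d, G.source d = x ∧ G.target d = y)
      (G.source (e₀, true)) v → ∀ d : E × Bool, G.source d = v → d.1 ∈ T := by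
    intro v hv
    induction hv with
    | refl => exact fun d hd => hrot (e₀, true) d he₀ hd
    | tail _ hstep ih =>
      obtain ⟨a, ha, hb⟩ := hstep
      exact fun d hd => hrot (rev a) d (ih a ha) (by rw [hd, source_rev, hb])
  exact hvert (G.source (e, true)) (hG _ _) (e, true) rfl

theorem FaceStep.source_eq {d d' : E × Bool} (h : G.FaceStep d d') :
    G.source d' = G.target d :=
  h.1.trans (G.source_rev d)

/-- The dart at index i joins the vertices at indices i and i + 1. A repeated edge would repeat a
source, or a source would recur as a later target. Hence facial paths are among the trails of
`Nonrepetitive`, which require only distinct edges. -/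
theorem IsFacialPath.nodup_edges {p : List (E × Bool)} (hp : G.IsFacialPath p) :
    (p.map Prod.fst).Nodup := by
  obtain ⟨hchain, hnd⟩ := hp
  rw [List.isChain_iff_getElem] at hchain
  have htgt : ∀ i (hi : i < p.length), (G.vertices p)[i + 1]? = some (G.target p[i]) := by
    intro i hi
    cases p with
    | nil => simp at hi
    | cons d p =>
      rw [vertices, List.getElem?_cons_succ, List.getElem?_map, List.getElem?_eq_getElem hi,
        Option.map_some]
  have hsrc : ∀ i (hi : i < p.length), (G.vertices p)[i]? = some (G.source p[i]) := by
    intro i hi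
    cases i with
    | zero =>
      cases p with
      | nil => simp at hi
      | cons d p => simp [vertices]
    | succ i => rw [htgt i (by omega), (hchain i hi).source_eq]
  have hinj : ∀ (i j : ℕ) (v : V), (G.vertices p)[i]? = some v → (G.vertices p)[j]? = some v → i = j := by
    intro i j v hi hj
    obtain ⟨hi', hi⟩ := List.getElem?_eq_some_iff.1 hi
    obtain ⟨hj', hj⟩ := List.getElem?_eq_some_iff.1 hj
    exact hnd.getElem_inj_iff.1 (hi.trans hj.symm)
  rw [List.nodup_iff_pairwise_ne, List.pairwise_iff_getElem]
  intro i j hi hj hij h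
  rw [List.length_map] at hi hj
  rw [List.getElem_map, List.getElem_map] at h
  by_cases hb : p[i].2 = p[j].2
  · have := hinj i j _ (hsrc i hi) (by rw [hsrc j hj, Prod.ext h hb])
    omega
  · have hr : p[j] = rev p[i] := Prod.ext h.symm (Bool.eq_not.2 fun h => hb h.symm)
    have := hinj i (j + 1) _ (hsrc i hi) (by rw [htgt j hj, hr, target_rev])
    omega

theorem isFaciallyNonrepetitive_of_nonrepetitive {C : Type*} {f : Equiv.Perm (E × Bool)}
    (hf : ∀ d d', G.FaceStep d d' ↔ d' = f d) {φ : E → Option C} (hφ : Nonrepetitive f φ) :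
    G.IsFaciallyNonrepetitive φ := by
  intro p hp w hw heq
  have hlen : p.length = 2 * w.length := by
    have := congrArg List.length heq
    simp only [List.length_map, List.length_append] at this
    omega
  have hwpos : 0 < w.length := List.length_pos_iff.2 hw
  have hp0 : 0 < p.length := by omega
  have hchain := List.isChain_iff_getElem.1 hp.1
  have hget : ∀ i (hi : i < p.length), p[i] = (f ^ i) p[0] := by
    intro i
    induction i with
    | zero => intro hi; simp
    | succ i ih =>
      intro hi
      rw [(hf _ _).1 (hchain i hi), ih (by omega), pow_succ', Equiv.Perm.mul_apply]
  have hcol : ∀ i (hi : i < p.length),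
      φ (edgeAt f p[0] i) = some ((w ++ w)[i]'(by rw [List.length_append]; omega)) := by
    intro i hi
    rw [edgeAt, ← hget i hi]
    have h1 : (p.map fun d => φ d.1)[i]'(by simpa using hi) = φ p[i].1 := by simp
    rw [← h1]
    simp only [heq, List.getElem_map]
  refine hφ p[0] w.length hwpos ?_ (fun i hi => by simp [hcol i (hlen ▸ hi)]) fun i hi => ?_
  · intro i hi j hj h
    rw [Set.mem_Iio, ← hlen] at hi hj
    rw [edgeAt, edgeAt, ← hget i hi, ← hget j hj] at h
    refine (hp.nodup_edges.getElem_inj_iff (hi := by simpa using hi) (hj := by simpa using hj)).1 ?_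
    simpa using h
  · rw [hcol i (by omega), hcol (i + w.length) (by omega), List.getElem_append_left hi,
      List.getElem_append_right (by omega)]
    simp

end PlaneGraph

open FacialColoring in
theorem mainTheorem5 {V E C : Type*} [Finite V] [Finite E] (G : PlaneGraph V E)
    (hG : G.Connected) (eStar : E) (L : E → Finset C) (hL : ∀ e, (L e).card = 9) :
    ∃ φ : E → Option C,
      (∀ e, ∀ c, φ e = some c → c ∈ L e) ∧
      G.IsFaciallyNonrepetitive φ ∧
      φ eStar = none ∧
      ∀ e, e ≠ eStar → φ e ≠ none := by
  classical
  have := Fintype.ofFinite E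
  have : Nonempty E := ⟨eStar⟩
  obtain ⟨f, hf⟩ := G.exists_perm_faceStep
  obtain ⟨φ, hφ⟩ := goodColorings_nonempty (f := f) hL eStar
    (fun T hne hT => Finset.eq_univ_iff_forall.2
      (hG.mem_of_adjacent_closed hf (T := (T : Set E)) hne hT))
    (Finset.univ.erase eStar) (Finset.notMem_erase _ _)
  rw [mem_goodColorings] at hφ
  obtain ⟨h1, h2⟩ := mem_listColorings.1 hφ.1
  refine ⟨φ, fun e c hc => ?_, PlaneGraph.isFaciallyNonrepetitive_of_nonrepetitive hf hφ.2,
    h2 eStar (Finset.notMem_erase _ _), fun e he => ?_⟩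
  · obtain ⟨c', hc', h⟩ := h1 e (by
      by_contra hn
      rw [h2 e hn] at hc
      cases hc)
    rw [hc, Option.some_inj] at h
    exact h ▸ hc'
  · obtain ⟨c', -, h⟩ := h1 e (by simp [he])
    simp [h]
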